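/- Let $\mathcal X\subset\mathbb R^d$ be compact, let $\mathcal P$ be the set of Borel probability measures on $\mathcal X$, and let $\mathcal H$ be a real reproducing kernel Hilbert space on $\mathcal X$ with kernel $k$ satisfying $0\le k(x,x')\le K$ for all $x,x'\in\mathcal X$ and some constant $K>0$. For a probability measure $P$ on $\mathcal X$ let $\mu_P=\int k(x,\cdot)\,dP(x)\in\mathcal H$ be its kernel mean embedding, and assume that the distance $d_{\mathrm{MMD}}(P,Q)=\|\mu_P-\mu_Q\|_{\mathcal H}$ metrizes weak convergence on $\mathcal P$, i.e. $P_n\to P$ weakly if and only if $d_{\mathrm{MMD}}(P_n,P)\to 0$. Let $\hat Q_0=\frac1m\sum_{i=1}^m\delta_{\hat x_{0,i}}$ and $\hat Q_1=\frac1m\sum_{i=1}^m\delta_{\hat x_{1,i}}$ be the empirical measures of training samples in $\mathcal X$ ($m\ge 1$), let $0<\theta<\frac12\|\mu_{\hat Q_1}-\mu_{\hat Q_0}\|_{\mathcal H}$, and put $\mathcal P_l=\{P\in\mathcal P:\ d_{\mathrm{MMD}}(P,\hat Q_l)\le\theta\}$ for $l=0,1$. The infinite-alphabet problem is $$\frac12\,\sup_{P_0\in\mathcal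 P_0,\;P_1\in\mathcal P_1}\int\min\{p_0,p_1\}\,d\mu,$$ where $p_0,p_1$ are the densities of $P_0,P_1$ with respect to a common dominating measure $\mu$, e.g. $\mu=P_0+P_1$. Its optimal solutions $(P_0,P_1)\in\mathcal P_0\times\mathcal P_1$ are the pairs of least-favorable distributions. Let $z_1,z_2,\dots$ be i.i.d. samples from a probability distribution on $\mathcal X$ whose support is the whole of $\mathcal X$. Let $\mathcal P_l^N$ be the set of those $P\in\mathcal P_l$ that are supported on $\{z_1,\dots,z_N\}$, and consider the finite-sample approximation $$\frac12\,\sup_{P_0\in\mathcal P_0^N,\;P_1\in\mathcal P_1^N}\ \sum_{z\in\{z_1,\dots,z_N\}}\min\{P_0(\{z\}),P_1(\{z\})\},$$ where the sum runs over the distinct sample points. Then almost surely the following holds. For all sufficiently large $N$ the finite-sample approximation has an optimal solution; and for every choice of pairs $(P_0^{*,N},P_1^{*,N})$ of probability measures on $\mathcal X$ that are optimal solutions of it for all sufficiently large $N$, there are indices $N(1)<N(2)<\cdots$ and an optimal solution $(P_0',P_1')$ of the infinite-alphabet problem such that $P_0^{*,N(t)}\to P_0'$ and $P_1^{*,N(t)}\to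 P_1'$ weakly as $t\to\infty$. -/

import Mathlib

open MeasureTheory ProbabilityTheory Filter Topology

noncomputable section

namespace RobustTesting

section Embedding

variable {α : Type*} (H : Type*) [NormedAddCommGroup H] [InnerProductSpace ℝ H] [CompleteSpace H]
  [RKHS ℝ H α ℝ]

/-- The real-valued reproducing kernel `k(x, y)` of the RKHS `H`
(Mathlib's kernel is operator-valued; here the operators are `ℝ →L[ℝ] ℝ`). -/
def realKernel (x y : α) : ℝ := RKHS.kernel H x y 1

/-- The feature map `x ↦ k(x, ·)`. -/
def feature (x : α) : H := RKHS.kerFun H x 1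

variable [MeasurableSpace α]

/-- The kernel mean embedding `μ_P = ∫ k(x, ·) dP(x)` (a Bochner integral in `H`). -/
def meanEmbedding (P : Measure α) : H := ∫ x, feature H x ∂P

/-- The maximum mean discrepancy `‖μ_P - μ_Q‖` in `H`. -/
def mmd (P Q : Measure α) : ℝ := ‖meanEmbedding H P - meanEmbedding H Q‖

/-- The maximum mean discrepancy of `H` metrizes the weak convergence of probability measures. -/
def MetrizesWeakConvergence [TopologicalSpace α] [OpensMeasurableSpace α] : Prop :=
  ∀ (Ps : ℕ → ProbabilityMeasure α) (P : ProbabilityMeasure α),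
    Tendsto Ps atTop (𝓝 P) ↔
      Tendsto (fun n => mmd H (Ps n : Measure α) (P : Measure α)) atTop (𝓝 0)

/-- The uncertainty set: the probability measures within MMD distance `θ` of the nominal
measure `Q`. -/
def uncertaintySet (θ : ℝ) (Q : Measure α) : Set (ProbabilityMeasure α) :=
  {P | mmd H (P : Measure α) Q ≤ θ}

/-- The members of the uncertainty set which are supported on the finite set `S`. -/
def finiteUncertaintySet (θ : ℝ) (Q : Measure α) (S : Finset α) : Set (ProbabilityMeasure α) :=
  {P | (P : Measure α) (S : Set α)ᶜ = 0 ∧ mmd H (P : Measure α) Q ≤ θ}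

end Embedding

section Objective

variable {α : Type*} [MeasurableSpace α]

/-- The empirical measure `(1/m) ∑ᵢ δ_{xᵢ}`. -/
def empiricalMeasure {m : ℕ} (x : Fin m → α) : Measure α :=
  (m : ENNReal)⁻¹ • ∑ i, Measure.dirac (x i)

/-- `(1/2) ∫ min {p₀, p₁}`, where `p₀`, `p₁` are the densities of `P₀`, `P₁` with respect to the
reference measure `P₀ + P₁`. -/
def bayesObjective (P₀ P₁ : ProbabilityMeasure α) : ℝ :=
  (1 / 2) * ∫ x, min
      ((P₀ : Measure α).rnDeriv ((P₀ : Measure α) + (P₁ : Measure α)) x).toReal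
      ((P₁ : Measure α).rnDeriv ((P₀ : Measure α) + (P₁ : Measure α)) x).toReal
    ∂((P₀ : Measure α) + (P₁ : Measure α))

/-- `(1/2) ∑_{x ∈ S} min {P₀(x), P₁(x)}` for a finite set `S` of points. -/
def finiteObjective (S : Finset α) (P₀ P₁ : ProbabilityMeasure α) : ℝ :=
  (1 / 2) * ∑ x ∈ S, min ((P₀ : Measure α).real {x}) ((P₁ : Measure α).real {x})

end Objective

open Classical in
/-- The set of the first `N` sample points `z 0, …, z (N - 1)`. -/
def samplePoints {α : Type*} (z : ℕ → α) (N : ℕ) : Finset α :=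
  (Finset.range N).image z

section Optimal

variable {α : Type*} (H : Type*) [NormedAddCommGroup H] [InnerProductSpace ℝ H] [CompleteSpace H]
  [RKHS ℝ H α ℝ] [MeasurableSpace α]

/-- `(P₀, P₁)` is an optimal solution of the infinite-alphabet problem: it maximizes
`(1/2) ∫ min {p₀, p₁}` over the product of the two uncertainty sets with nominal measures
`Q₀`, `Q₁`. -/
def IsLeastFavorable (θ : ℝ) (Q₀ Q₁ : Measure α) (P₀ P₁ : ProbabilityMeasure α) : Prop :=
  P₀ ∈ uncertaintySet H θ Q₀ ∧ P₁ ∈ uncertaintySet H θ Q₁ ∧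
    ∀ R₀ ∈ uncertaintySet H θ Q₀, ∀ R₁ ∈ uncertaintySet H θ Q₁,
      bayesObjective R₀ R₁ ≤ bayesObjective P₀ P₁

/-- `(P₀, P₁)` is an optimal solution of the approximation of the problem by distributions
supported on the finite set `S`. -/
def IsFiniteOptimal (θ : ℝ) (Q₀ Q₁ : Measure α) (S : Finset α)
    (P₀ P₁ : ProbabilityMeasure α) : Prop :=
  P₀ ∈ finiteUncertaintySet H θ Q₀ S ∧ P₁ ∈ finiteUncertaintySet H θ Q₁ S ∧
    ∀ R₀ ∈ finiteUncertaintySet H θ Q₀ S, ∀ R₁ ∈ finiteUncertaintySet H θ Q₁ S,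
      finiteObjective S R₀ R₁ ≤ finiteObjective S P₀ P₁

end Optimal

end RobustTesting

end

open RobustTesting

namespace RobustTesting

/-! ### Bayes error as a minimum over tests -/

section Bayes

variable {α : Type*} [MeasurableSpace α]

/-! The objective is half the minimum over tests `A` of `P₀ A + P₁ Aᶜ`. This variational form yields
weak upper semicontinuity (`upperSemicontinuous_bayesObjective`) and data processing
(`bayesObjective_le_map`).

By compactness, finite optimizers have a weakly convergent subsequence, and its limit is feasible
because MMD is weakly continuous. To compare it with a feasible pair `(R₀, R₁)`, contract the pair
towards the nominal measures by a factor `c < 1`: this makes it strictly feasible and keeps at least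
`c` times its objective. Then push both measures forward by the nearest-point map to the sample.
Density of the sample gives weak convergence, so strict feasibility survives for large `N`, and data
processing shows that nothing is lost in the objective; lower semicontinuity is never needed. Upper
semicontinuity passes the comparison to the limit, and finally `c → 1`. -/

lemma integrable_min_rnDeriv (P₀ P₁ : ProbabilityMeasure α) :
    Integrable (fun x => min
      ((P₀ : Measure α).rnDeriv ((P₀ : Measure α) + (P₁ : Measure α)) x).toReal
      ((P₁ : Measure α).rnDeriv ((P₀ : Measure α) + (P₁ : Measure α)) x).toReal)
      ((P₀ : Measure α) + (P₁ : Measure α)) :=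
  Measure.integrable_toReal_rnDeriv.inf Measure.integrable_toReal_rnDeriv

lemma setIntegral_rnDeriv_add_left (P₀ P₁ : ProbabilityMeasure α) (A : Set α) :
    ∫ x in A, ((P₀ : Measure α).rnDeriv ((P₀ : Measure α) + (P₁ : Measure α)) x).toReal
      ∂((P₀ : Measure α) + (P₁ : Measure α)) = (P₀ : Measure α).real A :=
  Measure.setIntegral_toReal_rnDeriv
    (Measure.absolutelyContinuous_of_le (Measure.le_add_right le_rfl)) A

lemma setIntegral_rnDeriv_add_right (P₀ P₁ : ProbabilityMeasure α) (A : Set α) :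
    ∫ x in A, ((P₁ : Measure α).rnDeriv ((P₀ : Measure α) + (P₁ : Measure α)) x).toReal
      ∂((P₀ : Measure α) + (P₁ : Measure α)) = (P₁ : Measure α).real A :=
  Measure.setIntegral_toReal_rnDeriv
    (Measure.absolutelyContinuous_of_le (Measure.le_add_left le_rfl)) A

/-- The Bayes objective is at most half the sum of the error probabilities of any test. -/
lemma bayesObjective_le (P₀ P₁ : ProbabilityMeasure α) {A : Set α} (hA : MeasurableSet A) :
    bayesObjective P₀ P₁ ≤
      (1 / 2) * ((P₀ : Measure α).real A + (P₁ : Measure α).real Aᶜ) := by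
  have hint := integrable_min_rnDeriv P₀ P₁
  unfold bayesObjective
  rw [← integral_add_compl hA hint, ← setIntegral_rnDeriv_add_left P₀ P₁ A,
    ← setIntegral_rnDeriv_add_right P₀ P₁ Aᶜ]
  refine mul_le_mul_of_nonneg_left (add_le_add ?_ ?_) (by norm_num)
  · exact integral_mono hint.integrableOn Measure.integrable_toReal_rnDeriv.integrableOn
      fun x => min_le_left _ _
  · exact integral_mono hint.integrableOn Measure.integrable_toReal_rnDeriv.integrableOn
      fun x => min_le_right _ _

/-- The likelihood ratio test attains the Bayes objective. -/
lemma exists_bayesObjective_eq (P₀ P₁ : ProbabilityMeasure α) :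
    ∃ A : Set α, MeasurableSet A ∧
      bayesObjective P₀ P₁ = (1 / 2) * ((P₀ : Measure α).real A + (P₁ : Measure α).real Aᶜ) := by
  set p₀ := fun x => ((P₀ : Measure α).rnDeriv ((P₀ : Measure α) + (P₁ : Measure α)) x).toReal
    with hp₀
  set p₁ := fun x => ((P₁ : Measure α).rnDeriv ((P₀ : Measure α) + (P₁ : Measure α)) x).toReal
    with hp₁
  have hA : MeasurableSet {x | p₀ x ≤ p₁ x} :=
    measurableSet_le (Measure.measurable_rnDeriv _ _).ennreal_toReal
      (Measure.measurable_rnDeriv _ _).ennreal_toReal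
  refine ⟨_, hA, ?_⟩
  unfold bayesObjective
  rw [← integral_add_compl hA (integrable_min_rnDeriv P₀ P₁),
    ← setIntegral_rnDeriv_add_left P₀ P₁, ← setIntegral_rnDeriv_add_right P₀ P₁]
  congr 2
  · exact setIntegral_congr_fun hA fun x hx => min_eq_left hx
  · exact setIntegral_congr_fun hA.compl fun x hx =>
      min_eq_right (le_of_not_ge hx)

/-- Data processing: a measurable map cannot decrease the Bayes objective. -/
lemma bayesObjective_le_map {β : Type*} [MeasurableSpace β] (P₀ P₁ : ProbabilityMeasure α)
    {T : α → β} (hT : Measurable T) :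
    bayesObjective P₀ P₁ ≤
      bayesObjective (P₀.map hT.aemeasurable) (P₁.map hT.aemeasurable) := by
  obtain ⟨A, hA, h⟩ := exists_bayesObjective_eq (P₀.map hT.aemeasurable) (P₁.map hT.aemeasurable)
  rw [h]
  simp only [ProbabilityMeasure.toMeasure_map]
  rw [map_measureReal_apply hT hA, map_measureReal_apply hT hA.compl]
  exact bayesObjective_le P₀ P₁ (hT hA)

/-- The best test for the `R` pair has errors at least `c` times its errors for the `P` pair. This
bounds the loss caused by contraction. -/
lemma mul_bayesObjective_le_of_le {P₀ P₁ R₀ R₁ : ProbabilityMeasure α} {c : ℝ} (hc : 0 ≤ c)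
    (h₀ : ENNReal.ofReal c • (P₀ : Measure α) ≤ R₀)
    (h₁ : ENNReal.ofReal c • (P₁ : Measure α) ≤ R₁) :
    c * bayesObjective P₀ P₁ ≤ bayesObjective R₀ R₁ := by
  obtain ⟨A, hA, h⟩ := exists_bayesObjective_eq R₀ R₁
  have key : ∀ {P R : ProbabilityMeasure α} (B : Set α),
      ENNReal.ofReal c • (P : Measure α) ≤ R →
      c * (P : Measure α).real B ≤ (R : Measure α).real B := by
    intro P R B hPR
    have := ENNReal.toReal_mono (measure_ne_top _ _) (hPR B)
    simpa [Measure.real, ENNReal.toReal_ofReal hc] using this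
  rw [h]
  have := mul_le_mul_of_nonneg_left (bayesObjective_le P₀ P₁ hA) hc
  linarith [key A h₀, key Aᶜ h₁]

variable [MeasurableSingletonClass α]

lemma measureReal_eq_sum_of_support {P : ProbabilityMeasure α} {S : Finset α}
    (hP : (P : Measure α) (S : Set α)ᶜ = 0) (A : Set α) [DecidablePred (· ∈ A)] :
    (P : Measure α).real A = ∑ x ∈ S with x ∈ A, (P : Measure α).real {x} := by
  rw [← measureReal_inter_add_sdiff (s := A) S.measurableSet,
    measureReal_mono_null (s₁ := A \ (S : Set α)) (s₂ := (S : Set α)ᶜ) (fun x hx => hx.2)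
      (by simp [Measure.real, hP]), add_zero, sum_measureReal_singleton]
  congr 1
  ext x
  simp [and_comm]

/-- For distributions on a finite set, the finite objective is the Bayes objective. -/
lemma bayesObjective_eq_finiteObjective {P₀ P₁ : ProbabilityMeasure α} {S : Finset α}
    (h₀ : (P₀ : Measure α) (S : Set α)ᶜ = 0) (h₁ : (P₁ : Measure α) (S : Set α)ᶜ = 0) :
    bayesObjective P₀ P₁ = finiteObjective S P₀ P₁ := by
  classical
  have hsum : ∀ A : Set α, (P₀ : Measure α).real A + (P₁ : Measure α).real Aᶜ =
      ∑ x ∈ S, if x ∈ A then (P₀ : Measure α).real {x} else (P₁ : Measure α).real {x} := by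
    intro A
    rw [measureReal_eq_sum_of_support h₀, measureReal_eq_sum_of_support h₁, Finset.sum_ite]
    rfl
  apply le_antisymm
  -- The pointwise optimal test, cut down to `S` so that it is finite and hence measurable.
  · set A : Set α :=
      {x | x ∈ S ∧ (P₀ : Measure α).real {x} ≤ (P₁ : Measure α).real {x}} with hA
    have hAm : MeasurableSet A := (S.finite_toSet.subset fun x hx => hx.1).measurableSet
    refine (bayesObjective_le P₀ P₁ hAm).trans_eq ?_
    rw [hsum, finiteObjective]
    congr 1
    refine Finset.sum_congr rfl fun x hx => ?_
    simp only [hA, Set.mem_ofPred_eq, hx, true_and]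
    rw [min_def]
  · obtain ⟨A, -, h⟩ := exists_bayesObjective_eq P₀ P₁
    rw [h, hsum, finiteObjective]
    gcongr with x
    split_ifs
    exacts [min_le_left _ _, min_le_right _ _]

end Bayes

/-! ### Upper semicontinuity under weak convergence -/

section Semicontinuity

variable {α : Type*} [PseudoMetricSpace α] [MeasurableSpace α] [BorelSpace α]

lemma tendsto_measureReal_of_null_frontier {P : ProbabilityMeasure α} {E : Set α}
    (hE : (P : Measure α) (frontier E) = 0) :
    Tendsto (fun R : ProbabilityMeasure α => (R : Measure α).real E) (𝓝 P)
      (𝓝 ((P : Measure α).real E)) :=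
  (ENNReal.tendsto_toReal (measure_ne_top _ _)).comp
    (ProbabilityMeasure.tendsto_measure_of_null_frontier_of_tendsto' tendsto_id hE)

/-- Every measurable set is approximated by a common continuity set of two finite measures. -/
lemma exists_null_frontier_approx (P₀ P₁ : ProbabilityMeasure α) {A : Set α}
    (hA : MeasurableSet A) {ε : ℝ} (hε : 0 < ε) :
    ∃ E : Set α, MeasurableSet E ∧ (P₀ : Measure α) (frontier E) = 0 ∧
      (P₁ : Measure α) (frontier E) = 0 ∧
      (P₀ : Measure α).real E < (P₀ : Measure α).real A + ε ∧
      (P₁ : Measure α).real Eᶜ < (P₁ : Measure α).real Aᶜ + ε := by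
  obtain ⟨F, hFA, hF, hlt⟩ := hA.exists_isClosed_sdiff_lt (μ := (P₁ : Measure α))
    (measure_ne_top _ _) (ε := ENNReal.ofReal ε) (by simpa using hε)
  -- Using the sum makes the same radii work for both measures.
  obtain ⟨r, hr, hrn⟩ := exists_null_frontiers_thickening ((P₀ : Measure α) + (P₁ : Measure α)) F
  have hr' : Tendsto r atTop (𝓝[>] 0) :=
    tendsto_nhdsWithin_iff.2 ⟨hr, Eventually.of_forall fun n => (hrn n).1⟩
  have hlim : Tendsto (fun n => (P₀ : Measure α).real (Metric.thickening (r n) F)) atTop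
      (𝓝 ((P₀ : Measure α).real F)) :=
    (ENNReal.tendsto_toReal (measure_ne_top _ _)).comp
      ((tendsto_measure_thickening_of_isClosed ⟨1, one_pos, measure_ne_top _ _⟩ hF).comp hr')
  have hFle : (P₀ : Measure α).real F < (P₀ : Measure α).real A + ε :=
    (measureReal_mono hFA).trans_lt (by linarith)
  obtain ⟨n, hn⟩ := (hlim.eventually_lt_const hFle).exists
  have hnull := (hrn n).2
  rw [Measure.add_apply, add_eq_zero] at hnull
  refine ⟨_, Metric.isOpen_thickening.measurableSet, hnull.1, hnull.2, hn, ?_⟩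
  have hsub : (Metric.thickening (r n) F)ᶜ ⊆ Aᶜ ∪ A \ F := by
    intro x hx
    by_cases hxA : x ∈ A
    · exact Or.inr ⟨hxA, fun hxF => hx (Metric.self_subset_thickening (hrn n).1 F hxF)⟩
    · exact Or.inl hxA
  have hdiff : (P₁ : Measure α).real (A \ F) < ε := by
    rw [Measure.real]
    exact (ENNReal.lt_ofReal_iff_toReal_lt (measure_ne_top _ _)).1 hlt
  have := (measureReal_mono (μ := (P₁ : Measure α)) hsub).trans (measureReal_union_le _ _)
  linarith

/-- A nearly optimal test at the limit may be taken to be a continuity set of both measures; its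
errors are then continuous there and bound the objective nearby. -/
lemma upperSemicontinuous_bayesObjective :
    UpperSemicontinuous fun P : ProbabilityMeasure α × ProbabilityMeasure α =>
      bayesObjective P.1 P.2 := by
  rintro ⟨P₀, P₁⟩ y hy
  obtain ⟨A, hA, h⟩ := exists_bayesObjective_eq P₀ P₁
  obtain ⟨E, hE, hf₀, hf₁, h₀, h₁⟩ := exists_null_frontier_approx P₀ P₁ hA
    (ε := y - bayesObjective P₀ P₁) (sub_pos.2 hy)
  have hf₁' : (P₁ : Measure α) (frontier Eᶜ) = 0 := by rwa [frontier_compl]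
  have hlim : Tendsto (fun R : ProbabilityMeasure α × ProbabilityMeasure α =>
      (1 / 2) * ((R.1 : Measure α).real E + (R.2 : Measure α).real Eᶜ)) (𝓝 (P₀, P₁))
      (𝓝 ((1 / 2) * ((P₀ : Measure α).real E + (P₁ : Measure α).real Eᶜ))) :=
    (((tendsto_measureReal_of_null_frontier hf₀).comp (continuous_fst.tendsto (P₀, P₁))).add
      ((tendsto_measureReal_of_null_frontier hf₁').comp
        (continuous_snd.tendsto (P₀, P₁)))).const_mul _
  filter_upwards [hlim.eventually_lt_const (u := y) (by linarith)] with R hR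
  exact (bayesObjective_le R.1 R.2 hE).trans_lt hR

end Semicontinuity


/-! ### Closedness of support constraints -/

section Closed

variable {α : Type*} [MetricSpace α] [MeasurableSpace α] [BorelSpace α]

lemma isClosed_setOf_measure_compl_eq_zero {F : Set α} (hF : IsClosed F) :
    IsClosed {P : ProbabilityMeasure α | (P : Measure α) Fᶜ = 0} := by
  refine isClosed_iff_clusterPt.2 fun P hP => ?_
  have hne : (𝓝 P ⊓ 𝓟 {P : ProbabilityMeasure α | (P : Measure α) Fᶜ = 0}).NeBot := hP
  have hle := ProbabilityMeasure.le_liminf_measure_open_of_tendsto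
    (tendsto_id'.2 (inf_le_left :
      𝓝 P ⊓ 𝓟 {P : ProbabilityMeasure α | (P : Measure α) Fᶜ = 0} ≤ 𝓝 P)) hF.isOpen_compl
  have hz : (fun R : ProbabilityMeasure α => (R : Measure α) Fᶜ) =ᶠ[
      𝓝 P ⊓ 𝓟 {P : ProbabilityMeasure α | (P : Measure α) Fᶜ = 0}] fun _ => 0 :=
    mem_inf_of_right (fun R hR => hR)
  have hlim := liminf_congr hz
  rw [liminf_const] at hlim
  exact le_antisymm (hle.trans_eq hlim) zero_le

end Closed

/-! ### Continuity of MMD and finite optimizers -/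

section Embedding

variable {α : Type*} (H : Type*) [NormedAddCommGroup H] [InnerProductSpace ℝ H] [CompleteSpace H]
  [RKHS ℝ H α ℝ] [MeasurableSpace α]

lemma mmd_self (P : Measure α) : mmd H P P = 0 := by simp [mmd]

variable [MetricSpace α] [BorelSpace α]

variable {H}

/-- Dirac masses depend weakly continuously on their point, and their mean embeddings are the
features. -/
lemma MetrizesWeakConvergence.continuous_feature (h : MetrizesWeakConvergence (α := α) H) :
    Continuous (feature H : α → H) := by
  refine continuous_iff_seqContinuous.2 fun x y hxy => ?_
  have := (h (fun n => diracProba (x n)) (diracProba y)).1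
    ((continuous_diracProba.tendsto y).comp hxy)
  simp only [mmd, meanEmbedding, diracProba, ProbabilityMeasure.coe_mk, integral_dirac] at this
  exact tendsto_iff_norm_sub_tendsto_zero.2 this

variable [CompactSpace α]

lemma MetrizesWeakConvergence.integrable_feature (h : MetrizesWeakConvergence (α := α) H)
    (P : Measure α) [IsFiniteMeasure P] : Integrable (feature H : α → H) P :=
  h.continuous_feature.integrable_of_hasCompactSupport (HasCompactSupport.of_compactSpace _)

lemma MetrizesWeakConvergence.continuous_meanEmbedding
    (h : MetrizesWeakConvergence (α := α) H) :
    Continuous fun P : ProbabilityMeasure α => meanEmbedding H (P : Measure α) :=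
  continuous_iff_seqContinuous.2 fun Ps P hP =>
    tendsto_iff_norm_sub_tendsto_zero.2 ((h Ps P).1 hP)

lemma MetrizesWeakConvergence.continuous_mmd (h : MetrizesWeakConvergence (α := α) H)
    (Q : Measure α) : Continuous fun P : ProbabilityMeasure α => mmd H (P : Measure α) Q :=
  (h.continuous_meanEmbedding.sub continuous_const).norm

lemma MetrizesWeakConvergence.isClosed_uncertaintySet
    (h : MetrizesWeakConvergence (α := α) H) (θ : ℝ) (Q : Measure α) :
    IsClosed (uncertaintySet H θ Q) :=
  isClosed_le (h.continuous_mmd Q) continuous_const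

lemma MetrizesWeakConvergence.isClosed_finiteUncertaintySet
    (h : MetrizesWeakConvergence (α := α) H) (θ : ℝ) (Q : Measure α) (S : Finset α) :
    IsClosed (finiteUncertaintySet H θ Q S) :=
  (isClosed_setOf_measure_compl_eq_zero S.finite_toSet.isClosed).inter
    (isClosed_le (h.continuous_mmd Q) continuous_const)

/-- The finite problem has an optimal solution as soon as it is feasible. -/
lemma MetrizesWeakConvergence.exists_isFiniteOptimal
    (h : MetrizesWeakConvergence (α := α) H) {θ : ℝ} {Q₀ Q₁ : Measure α} {S : Finset α}
    (h₀ : (finiteUncertaintySet H θ Q₀ S).Nonempty)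
    (h₁ : (finiteUncertaintySet H θ Q₁ S).Nonempty) :
    ∃ P₀ P₁ : ProbabilityMeasure α, IsFiniteOptimal H θ Q₀ Q₁ S P₀ P₁ := by
  obtain ⟨⟨P₀, P₁⟩, hP, hmax⟩ := UpperSemicontinuousOn.exists_isMaxOn (h₀.prod h₁)
    ((h.isClosed_finiteUncertaintySet θ Q₀ S).isCompact.prod
      (h.isClosed_finiteUncertaintySet θ Q₁ S).isCompact)
    (upperSemicontinuous_bayesObjective.upperSemicontinuousOn _)
  refine ⟨P₀, P₁, hP.1, hP.2, fun R₀ hR₀ R₁ hR₁ => ?_⟩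
  rw [← bayesObjective_eq_finiteObjective hP.1.1 hP.2.1,
    ← bayesObjective_eq_finiteObjective hR₀.1 hR₁.1]
  exact hmax (Set.mk_mem_prod hR₀ hR₁)

/-- Moving towards the nominal measure shrinks the maximum mean discrepancy. -/
lemma MetrizesWeakConvergence.exists_mixture (h : MetrizesWeakConvergence (α := α) H)
    (R Q : ProbabilityMeasure α) {c : ℝ} (hc₀ : 0 ≤ c) (hc₁ : c ≤ 1) :
    ∃ M : ProbabilityMeasure α, ENNReal.ofReal c • (R : Measure α) ≤ M ∧
      mmd H (M : Measure α) (Q : Measure α) = c * mmd H (R : Measure α) (Q : Measure α) := by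
  have hc₁' : 0 ≤ 1 - c := sub_nonneg.2 hc₁
  have hprob : IsProbabilityMeasure
      (ENNReal.ofReal c • (R : Measure α) + ENNReal.ofReal (1 - c) • (Q : Measure α)) :=
    ⟨by simp [← ENNReal.ofReal_add hc₀ hc₁']⟩
  refine ⟨⟨_, hprob⟩, Measure.le_add_right le_rfl, ?_⟩
  have hR := h.integrable_feature (R : Measure α)
  have hQ := h.integrable_feature (Q : Measure α)
  have hemb : meanEmbedding H
      (ENNReal.ofReal c • (R : Measure α) + ENNReal.ofReal (1 - c) • (Q : Measure α)) =
      c • meanEmbedding H (R : Measure α) + (1 - c) • meanEmbedding H (Q : Measure α) := by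
    unfold meanEmbedding
    rw [integral_add_measure (hR.smul_measure ENNReal.ofReal_ne_top)
      (hQ.smul_measure ENNReal.ofReal_ne_top), integral_smul_measure, integral_smul_measure,
      ENNReal.toReal_ofReal hc₀, ENNReal.toReal_ofReal hc₁']
  have hsub : meanEmbedding H
      (ENNReal.ofReal c • (R : Measure α) + ENNReal.ofReal (1 - c) • (Q : Measure α)) -
      meanEmbedding H (Q : Measure α) =
      c • (meanEmbedding H (R : Measure α) - meanEmbedding H (Q : Measure α)) := by
    rw [hemb]
    module
  simp only [mmd, ProbabilityMeasure.coe_mk]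
  rw [hsub, norm_smul, Real.norm_of_nonneg hc₀]

end Embedding

/-! ### Projection to the sample and passage to the limit -/

section Discretization

variable {α : Type*} [MetricSpace α] [MeasurableSpace α] [BorelSpace α]

lemma nearestPt_mem_samplePoints (z : ℕ → α) (N : ℕ) (x : α) :
    SimpleFunc.nearestPt z N x ∈ samplePoints z (N + 1) := by
  classical
  exact Finset.mem_image.2 ⟨SimpleFunc.nearestPtInd z N x,
    Finset.mem_range.2 (Nat.lt_succ_of_le (SimpleFunc.nearestPtInd_le z N x)), rfl⟩

/-- The projection of `P` to the nearest points among `z 0, …, z N`. -/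
noncomputable def discretization (z : ℕ → α) (P : ProbabilityMeasure α) (N : ℕ) :
    ProbabilityMeasure α :=
  P.map (SimpleFunc.nearestPt z N).measurable.aemeasurable

lemma discretization_compl_samplePoints (z : ℕ → α) (P : ProbabilityMeasure α) (N : ℕ) :
    (discretization z P N : Measure α) (samplePoints z (N + 1) : Set α)ᶜ = 0 := by
  rw [discretization, ProbabilityMeasure.toMeasure_map,
    Measure.map_apply (SimpleFunc.nearestPt z N).measurable
      (samplePoints z (N + 1)).measurableSet.compl]
  convert! measure_empty (μ := (P : Measure α))
  ext x
  simpa using nearestPt_mem_samplePoints z N x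

lemma tendsto_discretization {z : ℕ → α} (hz : DenseRange z) (P : ProbabilityMeasure α) :
    Tendsto (discretization z P) atTop (𝓝 P) := by
  refine ProbabilityMeasure.tendsto_iff_forall_integral_tendsto.2 fun f => ?_
  have hmap : ∀ N, ∫ x, f x ∂(discretization z P N : Measure α) =
      ∫ x, f (SimpleFunc.nearestPt z N x) ∂(P : Measure α) := fun N => by
    rw [discretization, ProbabilityMeasure.toMeasure_map]
    exact integral_map (SimpleFunc.nearestPt z N).measurable.aemeasurable
      f.continuous.measurable.aestronglyMeasurable
  simp_rw [hmap]
  refine tendsto_integral_of_dominated_convergence (fun _ => ‖f‖)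
    (fun N => (f.continuous.measurable.comp
      (SimpleFunc.nearestPt z N).measurable).aestronglyMeasurable)
    (integrable_const _) (fun N => Eventually.of_forall fun x => f.norm_coe_le_norm _)
    (Eventually.of_forall fun x => ?_)
  exact (f.continuous.tendsto x).comp (SimpleFunc.tendsto_nearestPt (hz x))

variable {H : Type*} [NormedAddCommGroup H] [InnerProductSpace ℝ H] [CompleteSpace H]
  [RKHS ℝ H α ℝ] [CompactSpace α]

/-- Feasible pairs are approximated by feasible pairs supported on a dense sample, with almost
no loss in the objective. -/
lemma MetrizesWeakConvergence.eventually_exists_finite_pair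
    (h : MetrizesWeakConvergence (α := α) H) {z : ℕ → α} (hz : DenseRange z) {θ : ℝ}
    (hθ : 0 < θ) {Q₀ Q₁ R₀ R₁ : ProbabilityMeasure α}
    (hR₀ : R₀ ∈ uncertaintySet H θ (Q₀ : Measure α))
    (hR₁ : R₁ ∈ uncertaintySet H θ (Q₁ : Measure α)) {c : ℝ} (hc₀ : 0 ≤ c) (hc₁ : c < 1) :
    ∀ᶠ N in atTop, ∃ M₀ ∈ finiteUncertaintySet H θ (Q₀ : Measure α) (samplePoints z N),
      ∃ M₁ ∈ finiteUncertaintySet H θ (Q₁ : Measure α) (samplePoints z N),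
        c * bayesObjective R₀ R₁ ≤ finiteObjective (samplePoints z N) M₀ M₁ := by
  obtain ⟨M₀, hM₀, hd₀⟩ := h.exists_mixture R₀ Q₀ hc₀ hc₁.le
  obtain ⟨M₁, hM₁, hd₁⟩ := h.exists_mixture R₁ Q₁ hc₀ hc₁.le
  have hlt : ∀ {M R Q : ProbabilityMeasure α}, R ∈ uncertaintySet H θ (Q : Measure α) →
      mmd H (M : Measure α) (Q : Measure α) = c * mmd H (R : Measure α) (Q : Measure α) →
      ∀ᶠ N in atTop, mmd H (discretization z M N : Measure α) (Q : Measure α) < θ := by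
    intro M R Q hR hd
    refine (((h.continuous_mmd (Q : Measure α)).tendsto M).comp
      (tendsto_discretization hz M)).eventually_lt_const ?_
    rw [hd]
    exact (mul_le_mul_of_nonneg_left hR hc₀).trans_lt (mul_lt_of_lt_one_left hθ hc₁)
  -- `nearestPt z N` uses the `N + 1` points `z 0, …, z N`, hence the shift.
  rw [← map_add_atTop_eq_nat 1, eventually_map]
  filter_upwards [hlt hR₀ hd₀, hlt hR₁ hd₁] with N h₀ h₁
  have hs₀ := discretization_compl_samplePoints z M₀ N
  have hs₁ := discretization_compl_samplePoints z M₁ N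
  refine ⟨_, ⟨hs₀, h₀.le⟩, _, ⟨hs₁, h₁.le⟩, ?_⟩
  rw [← bayesObjective_eq_finiteObjective hs₀ hs₁]
  exact (mul_bayesObjective_le_of_le hc₀ hM₀ hM₁).trans (bayesObjective_le_map M₀ M₁
    (SimpleFunc.nearestPt z N).measurable)

/-- For a dense sample, the optimal solutions of the finite problems exist and accumulate at a
pair of least-favorable distributions. -/
lemma MetrizesWeakConvergence.finiteOptimal_of_denseRange
    (h : MetrizesWeakConvergence (α := α) H) {z : ℕ → α} (hz : DenseRange z) {θ : ℝ}
    (hθ : 0 < θ) (Q₀ Q₁ : ProbabilityMeasure α) :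
    (∀ᶠ N in atTop, ∃ P₀ P₁ : ProbabilityMeasure α,
      IsFiniteOptimal H θ (Q₀ : Measure α) (Q₁ : Measure α) (samplePoints z N) P₀ P₁) ∧
    ∀ P₀s P₁s : ℕ → ProbabilityMeasure α,
      (∀ᶠ N in atTop, IsFiniteOptimal H θ (Q₀ : Measure α) (Q₁ : Measure α)
        (samplePoints z N) (P₀s N) (P₁s N)) →
      ∃ (φ : ℕ → ℕ) (P₀ P₁ : ProbabilityMeasure α), StrictMono φ ∧
        Tendsto (fun t => P₀s (φ t)) atTop (𝓝 P₀) ∧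
        Tendsto (fun t => P₁s (φ t)) atTop (𝓝 P₁) ∧
        IsLeastFavorable H θ (Q₀ : Measure α) (Q₁ : Measure α) P₀ P₁ := by
  constructor
  · have hQ : ∀ Q : ProbabilityMeasure α, Q ∈ uncertaintySet H θ (Q : Measure α) := fun Q =>
      (mmd_self H (Q : Measure α)).trans_le hθ.le
    -- Only feasibility matters here, so `c = 0` suffices.
    filter_upwards [h.eventually_exists_finite_pair hz hθ (hQ Q₀) (hQ Q₁) le_rfl one_pos]
      with N ⟨M₀, hM₀, M₁, hM₁, _⟩
    exact h.exists_isFiniteOptimal ⟨M₀, hM₀⟩ ⟨M₁, hM₁⟩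
  · intro P₀s P₁s hopt
    obtain ⟨⟨P₀, P₁⟩, φ, hφ, hlim⟩ := CompactSpace.tendsto_subseq fun N => (P₀s N, P₁s N)
    have hlim₀ : Tendsto (fun t => P₀s (φ t)) atTop (𝓝 P₀) :=
      (continuous_fst.tendsto (P₀, P₁)).comp hlim
    have hlim₁ : Tendsto (fun t => P₁s (φ t)) atTop (𝓝 P₁) :=
      (continuous_snd.tendsto (P₀, P₁)).comp hlim
    have hoptφ := hφ.tendsto_atTop.eventually hopt
    refine ⟨φ, P₀, P₁, hφ, hlim₀, hlim₁,
      (h.isClosed_uncertaintySet θ _).mem_of_tendsto hlim₀ (hoptφ.mono fun t ht => ht.1.2),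
      (h.isClosed_uncertaintySet θ _).mem_of_tendsto hlim₁ (hoptφ.mono fun t ht => ht.2.1.2),
      fun R₀ hR₀ R₁ hR₁ => ?_⟩
    have hscaled : ∀ c ∈ Set.Ico (0 : ℝ) 1, c * bayesObjective R₀ R₁ ≤ bayesObjective P₀ P₁ := by
      intro c hc
      by_contra! hlt
      -- At a late index, semicontinuity puts the finite optimum strictly below the value of a
      -- feasible competitor.
      obtain ⟨t, ht, hopt_t, M₀, hM₀, M₁, hM₁, hM⟩ :=
        ((hlim.eventually (upperSemicontinuous_bayesObjective (P₀, P₁) _ hlt)).and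
          (hoptφ.and (hφ.tendsto_atTop.eventually
            (h.eventually_exists_finite_pair hz hθ hR₀ hR₁ hc.1 hc.2)))).exists
      have := hopt_t.2.2 M₀ hM₀ M₁ hM₁
      rw [← bayesObjective_eq_finiteObjective hopt_t.1.1 hopt_t.2.1.1] at this
      exact ((hM.trans this).trans_lt ht).false
    have hc : Tendsto (fun c : ℝ => c * bayesObjective R₀ R₁) (𝓝[<] 1)
        (𝓝 (1 * bayesObjective R₀ R₁)) :=
      ((continuous_mul_const _).tendsto 1).mono_left nhdsWithin_le_nhds
    rw [one_mul] at hc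
    exact le_of_tendsto hc (mem_of_superset (Ico_mem_nhdsLT zero_lt_one) hscaled)

end Discretization

/-! ### Almost sure density of the sample -/

section Sampling

variable {α : Type*} [MeasurableSpace α]

lemma isProbabilityMeasure_empiricalMeasure {m : ℕ} (hm : 0 < m) (x : Fin m → α) :
    IsProbabilityMeasure (empiricalMeasure x) :=
  ⟨by simp [empiricalMeasure, ENNReal.inv_mul_cancel, hm.ne']⟩

variable {Ω : Type*} [MeasurableSpace Ω] {ν : Measure Ω} {P : Measure α} {z : ℕ → Ω → α}

/-- By independence the first `n` samples all miss `U` with probability `P Uᶜ ^ n`, which tends to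
zero. -/
lemma ae_exists_mem_of_iIndepFun [IsProbabilityMeasure P] (hz_meas : ∀ i, Measurable (z i))
    (hz_indep : iIndepFun z ν) (hz_law : ∀ i, ν.map (z i) = P) {U : Set α}
    (hU : MeasurableSet U) (hPU : 0 < P U) : ∀ᵐ ω ∂ν, ∃ i, z i ω ∈ U := by
  have hle : ∀ n : ℕ, ν {ω | ¬ ∃ i, z i ω ∈ U} ≤ P Uᶜ ^ n := by
    intro n
    calc ν {ω | ¬ ∃ i, z i ω ∈ U} ≤ ν (⋂ i ∈ Finset.range n, z i ⁻¹' Uᶜ) := by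
          refine measure_mono fun ω hω => ?_
          simp only [Set.mem_iInter]
          exact fun i _ hi => hω ⟨i, hi⟩
      _ = P Uᶜ ^ n := by
          rw [hz_indep.measure_inter_preimage_eq_mul _ (fun i _ => hU.compl)]
          simp_rw [← Measure.map_apply (hz_meas _) hU.compl, hz_law]
          simp
  have hlt : P Uᶜ < 1 := by
    rw [prob_compl_eq_one_sub hU]
    exact ENNReal.sub_lt_self ENNReal.one_ne_top one_ne_zero hPU.ne'
  exact le_antisymm (ge_of_tendsto' (ENNReal.tendsto_pow_atTop_nhds_zero_of_lt_one hlt) hle)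
    zero_le

/-- An i.i.d. sample from a distribution of full support is almost surely dense. -/
lemma ae_denseRange_of_iIndepFun [TopologicalSpace α] [SecondCountableTopology α]
    [OpensMeasurableSpace α] [IsProbabilityMeasure P] (hP : P.support = Set.univ)
    (hz_meas : ∀ i, Measurable (z i)) (hz_indep : iIndepFun z ν)
    (hz_law : ∀ i, ν.map (z i) = P) : ∀ᵐ ω ∂ν, DenseRange fun i => z i ω := by
  have hbasis := TopologicalSpace.isBasis_countableBasis α
  have hall : ∀ᵐ ω ∂ν, ∀ U ∈ TopologicalSpace.countableBasis α, U.Nonempty →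
      ∃ i, z i ω ∈ U := by
    refine (ae_ball_iff (TopologicalSpace.countable_countableBasis α)).2 fun U hU => ?_
    rcases U.eq_empty_or_nonempty with rfl | ⟨x, hx⟩
    · simp
    have hUo : IsOpen U := hbasis.isOpen hU
    have hx' : x ∈ P.support := hP ▸ Set.mem_univ x
    have hpos := (Measure.mem_support_iff_forall x).1 hx' U (hUo.mem_nhds hx)
    filter_upwards [ae_exists_mem_of_iIndepFun hz_meas hz_indep hz_law hUo.measurableSet hpos]
      with ω hω _
    exact hω
  filter_upwards [hall] with ω hω
  refine hbasis.dense_iff.2 fun U hU hne => ?_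
  obtain ⟨i, hi⟩ := hω U hU hne
  exact ⟨_, hi, i, rfl⟩

end Sampling

end RobustTesting

theorem proposition2
    {d : ℕ} (X : Set (EuclideanSpace ℝ (Fin d))) (hX : IsCompact X)
    -- the RKHS `H` of a bounded kernel on `X` whose MMD metrizes weak convergence
    (H : Type*) [NormedAddCommGroup H] [InnerProductSpace ℝ H] [CompleteSpace H] [RKHS ℝ H X ℝ]
    (K : ℝ) (hK : 0 < K) (hkernel : ∀ x y : X, 0 ≤ realKernel H x y ∧ realKernel H x y ≤ K)
    (hmetrize : MetrizesWeakConvergence (α := X) H)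
    -- the training samples, their empirical measures, and the radius
    {m : ℕ} (hm : 0 < m) (xhat₀ xhat₁ : Fin m → X)
    (θ : ℝ) (hθ : 0 < θ)
    (hθ_sep : θ < mmd H (empiricalMeasure xhat₁) (empiricalMeasure xhat₀) / 2)
    -- the i.i.d. sample `z 0, z 1, …` from a distribution `P` supported on the whole of `X`
    (P : Measure X) [IsProbabilityMeasure P] (hP : P.support = Set.univ)
    {Ω : Type*} [MeasurableSpace Ω] (ν : Measure Ω) [IsProbabilityMeasure ν]
    (z : ℕ → Ω → X) (hz_meas : ∀ i, Measurable (z i)) (hz_indep : iIndepFun z ν)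
    (hz_law : ∀ i, ν.map (z i) = P) :
    ∀ᵐ ω ∂ν,
      (∀ᶠ N in atTop, ∃ P₀ P₁ : ProbabilityMeasure X,
        IsFiniteOptimal H θ (empiricalMeasure xhat₀) (empiricalMeasure xhat₁)
          (samplePoints (fun i => z i ω) N) P₀ P₁) ∧
      ∀ P₀s P₁s : ℕ → ProbabilityMeasure X,
        (∀ᶠ N in atTop,
          IsFiniteOptimal H θ (empiricalMeasure xhat₀) (empiricalMeasure xhat₁)
            (samplePoints (fun i => z i ω) N) (P₀s N) (P₁s N)) →
        ∃ (φ : ℕ → ℕ) (P₀ P₁ : ProbabilityMeasure X), StrictMono φ ∧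
          Tendsto (fun t => P₀s (φ t)) atTop (𝓝 P₀) ∧
          Tendsto (fun t => P₁s (φ t)) atTop (𝓝 P₁) ∧
          IsLeastFavorable H θ (empiricalMeasure xhat₀) (empiricalMeasure xhat₁) P₀ P₁ := by
  have : CompactSpace X := isCompact_iff_compactSpace.1 hX
  have h₀ := isProbabilityMeasure_empiricalMeasure hm xhat₀
  have h₁ := isProbabilityMeasure_empiricalMeasure hm xhat₁
  filter_upwards [ae_denseRange_of_iIndepFun hP hz_meas hz_indep hz_law] with ω hω
  exact hmetrize.finiteOptimal_of_denseRange hω hθ ⟨_, h₀⟩ ⟨_, h₁⟩
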